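/- Let $G$ be a second countable locally compact (Hausdorff) group, $\Gamma\subset G$ a closed subgroup, and let $\mu_G$, $\mu_\Gamma$ be left Haar measures on $G$ and $\Gamma$. Give the space $\Gamma\backslash G$ of right cosets $\Gamma x$ the quotient topology and its Borel $\sigma$-algebra, and let $\gamma\colon \Gamma\backslash G\to G$ be a Borel measurable section of the quotient map $x\mapsto \Gamma x$ such that $\gamma(K)$ has compact closure in $G$ for every compact $K\subset\Gamma\backslash G$. Then there is a unique regular Borel measure $\mu_{\Gamma\backslash G}$ on $\Gamma\backslash G$ such that for every $f\in L^1(G,\mu_G)$ the function $\xi\mapsto f(\xi\gamma(\Gamma x))$ is in $L^1(\Gamma,\mu_\Gamma)$ for $\mu_{\Gamma\backslash G}$-a.e. $\Gamma x$, the function $\Gamma x\mapsto \int_\Gamma f(\xi\gamma(\Gamma x))\,d\mu_\Gamma(\xi)$ is in $L^1(\Gamma\backslash G,\mu_{\Gamma\backslash G})$, and $$\int_G f\,d\mu_G=\int_{\Gamma\backslash G}\int_\Gamma f(\xi\gamma(\Gamma x))\,d\mu_\Gamma(\xi)\,d\mu_{\Gamma\backslash G}(\Gamma x).$$ With this measure,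 the map $$T\colon(\Gamma\times\Gamma\backslash G,\ \mu_\Gamma\otimes\mu_{\Gamma\backslash G})\to(G,\mu_G),\qquad T(\xi,\Gamma x)=\xi\,\gamma(\Gamma x),$$ is an isomorphism of measure spaces: a Borel measurable bijection with Borel measurable inverse that carries $\mu_\Gamma\otimes\mu_{\Gamma\backslash G}$ to $\mu_G$. Consequently there is a unitary map $U\colon L^2(G,\mu_G)\to L^2(\Gamma\times\Gamma\backslash G,\mu_\Gamma\otimes\mu_{\Gamma\backslash G})$ such that, for every $f\in L^2(G,\mu_G)$, $(Uf)(\xi,\Gamma x)=f(\xi\gamma(\Gamma x))$ for $\mu_\Gamma\otimes\mu_{\Gamma\backslash G}$-a.e. $(\xi,\Gamma x)$. -/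

import Mathlib

open MeasureTheory

/-- The space `Γ \ G` of right cosets `Γx` of a subgroup `Γ` of `G`. -/
def RightCosets {G : Type*} [Group G] (Γ : Subgroup G) : Type _ :=
  Quotient (QuotientGroup.rightRel Γ)

namespace RightCosets

/-- The quotient map `x ↦ Γx`. -/
def mk {G : Type*} [Group G] (Γ : Subgroup G) (x : G) : RightCosets Γ :=
  Quotient.mk (QuotientGroup.rightRel Γ) x

/-- `Γ \ G` carries the quotient topology. -/
instance instTopologicalSpace {G : Type*} [Group G] [TopologicalSpace G] (Γ : Subgroup G) :
    TopologicalSpace (RightCosets Γ) :=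
  inferInstanceAs (TopologicalSpace (Quotient (QuotientGroup.rightRel Γ)))

/-- `Γ \ G` carries the Borel sigma-algebra of the quotient topology. -/
instance instMeasurableSpace {G : Type*} [Group G] [TopologicalSpace G] (Γ : Subgroup G) :
    MeasurableSpace (RightCosets Γ) :=
  borel (RightCosets Γ)

instance instBorelSpace {G : Type*} [Group G] [TopologicalSpace G] (Γ : Subgroup G) :
    BorelSpace (RightCosets Γ) :=
  ⟨rfl⟩

theorem mk_eq_mk_iff {G : Type*} [Group G] (Γ : Subgroup G) (x y : G) :
    mk Γ x = mk Γ y ↔ y * x⁻¹ ∈ Γ :=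
  Quotient.eq.trans QuotientGroup.rightRel_apply

end RightCosets

/-- `γ : Γ \ G → G` is a Borel section of the quotient map that sends compact sets to
sets with compact closure. -/
structure IsCompactBorelSection {G : Type*} [Group G] [TopologicalSpace G] [MeasurableSpace G]
    (Γ : Subgroup G) (γ : RightCosets Γ → G) : Prop where
  measurable : Measurable γ
  mk_section : ∀ c : RightCosets Γ, RightCosets.mk Γ (γ c) = c
  isCompact_closure_image : ∀ K : Set (RightCosets Γ), IsCompact K → IsCompact (closure (γ '' K))

/-- `ν` is a regular Borel measure on `Γ \ G` that satisfies the Weil formula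
`∫_G f dμ_G = ∫_{Γ\G} ∫_Γ f(ξ γ(Γx)) dμ_Γ(ξ) dν(Γx)` for all `f ∈ L¹(G)`, where it is part of the
formula that the inner integrals exist almost everywhere and that the outer one exists. -/
structure IsRightWeilMeasure {G : Type*} [Group G] [TopologicalSpace G] [MeasurableSpace G]
    (Γ : Subgroup G) (μG : Measure G) (μΓ : Measure Γ) (γ : RightCosets Γ → G)
    (ν : Measure (RightCosets Γ)) : Prop where
  regular : ν.Regular
  integrable_fiber : ∀ f : G → ℂ, Integrable f μG →
    ∀ᵐ c ∂ν, Integrable (fun ξ : Γ => f ((ξ : G) * γ c)) μΓ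
  integrable_integral : ∀ f : G → ℂ, Integrable f μG →
    Integrable (fun c => ∫ ξ : Γ, f ((ξ : G) * γ c) ∂μΓ) ν
  integral_eq : ∀ f : G → ℂ, Integrable f μG →
    ∫ x, f x ∂μG = ∫ c, ∫ ξ : Γ, f ((ξ : G) * γ c) ∂μΓ ∂ν

/-- The map `T(ξ, Γx) = ξ γ(Γx)`. -/
def cosetProductMap {G : Type*} [Group G] (Γ : Subgroup G) (γ : RightCosets Γ → G)
    (p : Γ × RightCosets Γ) : G :=
  (p.1 : G) * γ p.2

/-- `T : (X, μ) → (Y, ν)` is an isomorphism of measure spaces: a measurable bijection with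
measurable inverse that carries `μ` to `ν`. -/
def IsMeasureSpaceIso {X Y : Type*} [MeasurableSpace X] [MeasurableSpace Y]
    (T : X → Y) (μ : Measure X) (ν : Measure Y) : Prop :=
  ∃ e : X ≃ᵐ Y, (∀ x, e x = T x) ∧ MeasurePreserving T μ ν

/-! ### Topology of the coset space. -/

namespace RightCosets

variable {G : Type*} [Group G] [TopologicalSpace G]

/-! The section makes `T` a Borel isomorphism with inverse `x ↦ (x γ(Γx)⁻¹, Γx)`. Pulled back along
`T`, `μG` is invariant under left translation of the factor `Γ` and finite on products of compact
sets. Uniqueness of Haar measure on `Γ` then forces it to be a product `μΓ ⊗ ν`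
(`exists_prod_eq_of_left_invariant`). With this `ν`, the Weil formula is Fubini and `U` is
composition with `T`. Conversely, the formula for indicators of the sets `T(C × B)` determines `ν`
(`IsRightWeilMeasure.unique`), so every measure satisfying it is the one constructed. -/

theorem isOpenQuotientMap_mk [ContinuousMul G] (Γ : Subgroup G) : IsOpenQuotientMap (mk Γ) :=
  MulAction.isOpenQuotientMap_quotientMk (Γ := Γ) (T := G)

theorem t2Space [IsTopologicalGroup G] {Γ : Subgroup G} (hΓ : IsClosed (Γ : Set G)) :
    T2Space (RightCosets Γ) := by
  rw [t2Space_iff_of_isOpenQuotientMap (isOpenQuotientMap_mk Γ)]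
  simp only [mk_eq_mk_iff]
  exact hΓ.preimage (continuous_snd.mul continuous_fst.inv)

instance [IsTopologicalGroup G] [LocallyCompactSpace G] (Γ : Subgroup G) :
    LocallyCompactSpace (RightCosets Γ) :=
  (isOpenQuotientMap_mk Γ).locallyCompactSpace

instance [IsTopologicalGroup G] [SecondCountableTopology G] (Γ : Subgroup G) :
    SecondCountableTopology (RightCosets Γ) :=
  (isOpenQuotientMap_mk Γ).isQuotientMap.secondCountableTopology
    (isOpenQuotientMap_mk Γ).isOpenMap

end RightCosets

/-! ### Splitting off a Haar factor. -/

/-- A measure on `H × Y` that is invariant under left translation of the first factor and finite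
on the products of compact sets with the members of a countable cover of `Y` is the product of a
Haar measure with a measure on `Y`. -/
theorem exists_prod_eq_of_left_invariant {H Y : Type*} [Group H] [TopologicalSpace H]
    [IsTopologicalGroup H] [LocallyCompactSpace H] [SecondCountableTopology H]
    [MeasurableSpace H] [BorelSpace H] [MeasurableSpace Y]
    (μ : Measure H) [μ.IsHaarMeasure] (m : Measure (H × Y)) (K : ℕ → Set Y)
    (hK : ∀ n, MeasurableSet (K n)) (hcover : ⋃ n, K n = Set.univ)
    (hfin : ∀ C : Set H, IsCompact C → ∀ n, m (C ×ˢ K n) < ⊤)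
    (hinv : ∀ η : H, m.map (fun p => (η * p.1, p.2)) = m) :
    ∃ ν : Measure Y, (∀ n, ν (K n) < ⊤) ∧ μ.prod ν = m := by
  -- For fixed `B`, `S ↦ m (S × B)` is left invariant and finite on compact sets, hence a multiple
  -- of `μ`.
  have slice : ∀ (B : Set Y), MeasurableSet B → (∃ n, B ⊆ K n) →
      ∃ c : ENNReal, ∀ S : Set H, MeasurableSet S → m (S ×ˢ B) = c * μ S := by
    rintro B hB ⟨n, hn⟩
    let κ : Measure H := (m.restrict (Set.univ ×ˢ B)).map Prod.fst
    have hκ : ∀ S : Set H, MeasurableSet S → κ S = m (S ×ˢ B) := by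
      intro S hS
      rw [Measure.map_apply measurable_fst hS, Measure.restrict_apply (measurable_fst hS)]
      congr 1
      ext p
      simp
    have hcompact : IsFiniteMeasureOnCompacts κ := by
      refine ⟨fun C hC => ?_⟩
      -- `H` need not be Hausdorff, so `C` may fail to be measurable; its closure is measurable and
      -- still compact.
      refine (measure_mono subset_closure).trans_lt ?_
      rw [hκ _ isClosed_closure.measurableSet]
      exact (measure_mono (Set.prod_mono le_rfl hn)).trans_lt (hfin _ hC.closure n)
    have hleft : κ.IsMulLeftInvariant := by
      refine ⟨fun η => Measure.ext fun S hS => ?_⟩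
      have hmeas : Measurable (fun h : H => η * h) := measurable_const_mul η
      have hmeas' : Measurable (fun p : H × Y => (η * p.1, p.2)) := by fun_prop
      rw [Measure.map_apply hmeas hS, hκ _ (hmeas hS), hκ _ hS]
      conv_rhs => rw [← hinv η]
      rw [Measure.map_apply hmeas' (hS.prod hB)]
      rfl
    refine ⟨Measure.haarScalarFactor κ μ, fun S hS => ?_⟩
    rw [← hκ S hS]
    conv_lhs => rw [Measure.isMulLeftInvariant_eq_smul κ μ]
    rfl
  obtain ⟨A⟩ : Nonempty (TopologicalSpace.PositiveCompacts H) := inferInstance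
  let C : Set H := closure A
  have hC : IsCompact C := A.isCompact.closure
  have hCm : MeasurableSet C := isClosed_closure.measurableSet
  have hC0 : μ C ≠ 0 :=
    (A.interior_nonempty.mono (interior_mono subset_closure) |>
      Measure.measure_pos_of_nonempty_interior μ).ne'
  have hCt : μ C ≠ ⊤ := hC.measure_lt_top.ne
  let τ : Set H → Measure Y := fun S => (m.restrict (S ×ˢ Set.univ)).map Prod.snd
  have hτ : ∀ S B, MeasurableSet B → τ S B = m (S ×ˢ B) := by
    intro S B hB
    rw [Measure.map_apply measurable_snd hB, Measure.restrict_apply (measurable_snd hB)]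
    congr 1
    ext p
    simp [and_comm]
  -- On `B ∩ K n` both sides equal `c * μ S * μ C`; comparing with the fixed set `C` eliminates the
  -- constant `c`, which depends on the slice.
  have hswap : ∀ S, MeasurableSet S → μ C • τ S = μ S • τ C := by
    intro S hS
    rw [Measure.ext_iff_of_iUnion_eq_univ hcover]
    refine fun n => Measure.ext fun B hB => ?_
    obtain ⟨c, hc⟩ := slice (B ∩ K n) (hB.inter (hK n)) ⟨n, Set.inter_subset_right⟩
    simp only [Measure.restrict_apply hB, Measure.smul_apply, smul_eq_mul,
      hτ _ _ (hB.inter (hK n)), hc S hS, hc C hCm]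
    ring
  let ν : Measure Y := (μ C)⁻¹ • τ C
  have hν : ∀ n, ν (K n) < ⊤ := fun n => by
    simp only [ν, Measure.smul_apply, smul_eq_mul, hτ _ _ (hK n)]
    exact ENNReal.mul_lt_top (ENNReal.inv_lt_top.2 hC0.bot_lt) (hfin C hC n)
  have hσ : SigmaFinite ν := ⟨⟨⟨K, fun _ => trivial, hν, hcover⟩⟩⟩
  refine ⟨ν, hν, Measure.prod_eq fun S B hS hB => ?_⟩
  have h := congrArg (fun ρ : Measure Y => ρ B) (hswap S hS)
  simp only [Measure.smul_apply, smul_eq_mul, hτ _ _ hB] at h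
  simp only [ν, Measure.smul_apply, smul_eq_mul, hτ _ _ hB]
  rw [mul_left_comm, ← h, ← mul_assoc, ENNReal.inv_mul_cancel hC0 hCt, one_mul]

/-! ### The section on compact sets. -/

section

variable {G : Type*} [Group G] [TopologicalSpace G] [MeasurableSpace G]
  {Γ : Subgroup G} {γ : RightCosets Γ → G}

theorem IsCompactBorelSection.mul_inv_mem (hγ : IsCompactBorelSection Γ γ) (x : G) :
    x * (γ (RightCosets.mk Γ x))⁻¹ ∈ Γ :=
  (RightCosets.mk_eq_mk_iff Γ _ _).1 (hγ.mk_section _)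

theorem IsCompactBorelSection.mk_mul (hγ : IsCompactBorelSection Γ γ) (ξ : Γ)
    (c : RightCosets Γ) : RightCosets.mk Γ ((ξ : G) * γ c) = c := by
  conv_rhs => rw [← hγ.mk_section c]
  rw [RightCosets.mk_eq_mk_iff]
  simp

/-- The image lies in the compact set `C * closure (γ '' K)`. This is where the compactness
condition on `γ` enters. -/
theorem IsCompactBorelSection.measure_image_prod_lt_top [ContinuousMul G]
    (hγ : IsCompactBorelSection Γ γ) (μG : Measure G) [IsFiniteMeasureOnCompacts μG] {C : Set Γ} (hC : IsCompact C)
    {K : Set (RightCosets Γ)} (hK : IsCompact K) :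
    μG (cosetProductMap Γ γ '' (C ×ˢ K)) < ⊤ := by
  refine (measure_mono ?_).trans_lt
    ((((hC.image continuous_subtype_val).prod (hγ.isCompact_closure_image K hK)).image
      continuous_mul).measure_lt_top (μ := μG))
  rintro _ ⟨⟨ξ, c⟩, ⟨hξ, hc⟩, rfl⟩
  exact ⟨((ξ : G), γ c), ⟨⟨ξ, hξ, rfl⟩, subset_closure ⟨c, hc, rfl⟩⟩, rfl⟩

end

/-! ### Existence and uniqueness of the quotient measure. -/

section

variable {G : Type*} [Group G] [TopologicalSpace G] [IsTopologicalGroup G]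
  [SecondCountableTopology G] [MeasurableSpace G] [BorelSpace G]
  {Γ : Subgroup G} {γ : RightCosets Γ → G}

/-- A Borel section identifies `Γ × Γ \ G` with `G` as measurable spaces. -/
noncomputable def IsCompactBorelSection.measurableEquiv (hγ : IsCompactBorelSection Γ γ) :
    Γ × RightCosets Γ ≃ᵐ G where
  toFun := cosetProductMap Γ γ
  invFun x := (⟨x * (γ (RightCosets.mk Γ x))⁻¹, hγ.mul_inv_mem x⟩, RightCosets.mk Γ x)
  left_inv p := by
    refine Prod.ext (Subtype.ext ?_) ?_ <;> simp [cosetProductMap, hγ.mk_mul]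
  right_inv x := by simp [cosetProductMap]
  measurable_toFun :=
    (measurable_subtype_coe.comp measurable_fst).mul (hγ.measurable.comp measurable_snd)
  measurable_invFun := by
    have hmk : Measurable (RightCosets.mk Γ) :=
      (RightCosets.isOpenQuotientMap_mk Γ).continuous.measurable
    exact ((measurable_id.mul (hγ.measurable.comp hmk).inv).subtype_mk).prodMk hmk

theorem IsCompactBorelSection.exists_measurePreserving [T2Space G] [LocallyCompactSpace G]
    (hγ : IsCompactBorelSection Γ γ) (hΓ : IsClosed (Γ : Set G))
    (μG : Measure G) [μG.IsHaarMeasure] (μΓ : Measure Γ) [μΓ.IsHaarMeasure] :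
    ∃ ν : Measure (RightCosets Γ), ν.Regular ∧
      MeasurePreserving (cosetProductMap Γ γ) (μΓ.prod ν) μG := by
  have := RightCosets.t2Space hΓ
  have : LocallyCompactSpace Γ := hΓ.isClosedEmbedding_subtypeVal.locallyCompactSpace
  have : SecondCountableTopology Γ :=
    TopologicalSpace.Subtype.secondCountableTopology (Γ : Set G)
  let e := hγ.measurableEquiv
  have he : ∀ s, μG.map e.symm s = μG (cosetProductMap Γ γ '' s) := fun s => by
    rw [e.symm.map_apply, ← e.image_eq_preimage_symm]
    rfl
  let K : CompactExhaustion (RightCosets Γ) := default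
  obtain ⟨ν, hν, hprod⟩ := exists_prod_eq_of_left_invariant μΓ (μG.map e.symm) K
    (fun n => (K.isCompact n).isClosed.measurableSet) K.iUnion_eq
    (fun C hC n => by
      rw [he]
      exact hγ.measure_image_prod_lt_top μG hC (K.isCompact n))
    (fun η => by
      have hmeas : Measurable (fun p : Γ × RightCosets Γ => (η * p.1, p.2)) := by fun_prop
      rw [Measure.map_map hmeas e.symm.measurable]
      -- `T` intertwines translation of the first factor with left translation on `G`, which
      -- preserves `μG`.
      have hcomm : (fun p : Γ × RightCosets Γ => (η * p.1, p.2)) ∘ e.symm =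
          e.symm ∘ fun x => (η : G) * x := by
        funext x
        obtain ⟨p, rfl⟩ := e.surjective x
        have hmul : (η : G) * e p = e (η * p.1, p.2) :=
          (mul_assoc (η : G) (p.1 : G) (γ p.2)).symm
        simp [hmul]
      rw [hcomm, ← Measure.map_map e.symm.measurable (measurable_const_mul _),
        map_mul_left_eq_self])
  have hlf : IsLocallyFiniteMeasure ν := by
    refine ⟨fun c => ?_⟩
    obtain ⟨n, hn⟩ := K.exists_mem_nhds c
    exact ⟨K n, hn, hν n⟩
  -- Regularity is automatic: `ν` is locally finite on a second countable locally compact Hausdorff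
  -- space.
  refine ⟨ν, inferInstance, hγ.measurableEquiv.measurable, ?_⟩
  rw [hprod]
  exact e.map_map_symm

theorem IsRightWeilMeasure.of_measurePreserving [T2Space G] [LocallyCompactSpace G]
    (hγ : IsCompactBorelSection Γ γ) (hΓ : IsClosed (Γ : Set G))
    {μG : Measure G} {μΓ : Measure Γ} [μΓ.IsHaarMeasure]
    {ν : Measure (RightCosets Γ)} (hν : ν.Regular)
    (h : MeasurePreserving (cosetProductMap Γ γ) (μΓ.prod ν) μG) :
    IsRightWeilMeasure Γ μG μΓ γ ν := by
  have : LocallyCompactSpace Γ := hΓ.isClosedEmbedding_subtypeVal.locallyCompactSpace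
  have : SecondCountableTopology Γ :=
    TopologicalSpace.Subtype.secondCountableTopology (Γ : Set G)
  have hint : ∀ f : G → ℂ, Integrable f μG →
      Integrable (fun p => f (cosetProductMap Γ γ p)) (μΓ.prod ν) :=
    fun f hf => h.integrable_comp_of_integrable hf
  refine ⟨hν, fun f hf => (hint f hf).prod_left_ae, fun f hf => (hint f hf).integral_prod_right,
    fun f hf => ?_⟩
  rw [← h.integral_comp hγ.measurableEquiv.measurableEmbedding f]
  exact integral_prod_symm _ (hint f hf)

/-- Apply the Weil formula to the indicator of `T(C × B)`; as `T` is injective, its inner integral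
is `μΓ(C)` times the indicator of `B`. -/
theorem IsRightWeilMeasure.measure_eq (hγ : IsCompactBorelSection Γ γ)
    {μG : Measure G} [IsFiniteMeasureOnCompacts μG] {μΓ : Measure Γ}
    {ν : Measure (RightCosets Γ)} (hν : IsRightWeilMeasure Γ μG μΓ γ ν)
    {C : Set Γ} (hC : IsCompact C) (hCm : MeasurableSet C)
    {K B : Set (RightCosets Γ)} (hK : IsCompact K) (hB : MeasurableSet B) (hBK : B ⊆ K) :
    μG.real (cosetProductMap Γ γ '' (C ×ˢ B)) = μΓ.real C * ν.real B := by
  have hm : MeasurableSet (cosetProductMap Γ γ '' (C ×ˢ B)) :=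
    hγ.measurableEquiv.measurableEmbedding.measurableSet_image.2 (hCm.prod hB)
  have hfin : μG (cosetProductMap Γ γ '' (C ×ˢ B)) ≠ ⊤ :=
    ((measure_mono (Set.image_mono (Set.prod_mono le_rfl hBK))).trans_lt
      (hγ.measure_image_prod_lt_top μG hC hK)).ne
  have hformula := hν.integral_eq
    ((cosetProductMap Γ γ '' (C ×ˢ B)).indicator fun _ => (1 : ℂ))
    ((integrable_indicator_iff hm).2 (integrableOn_const hfin))
  have hinner : ∀ c, ∫ ξ : Γ, (cosetProductMap Γ γ '' (C ×ˢ B)).indicator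
      (fun _ => (1 : ℂ)) ((ξ : G) * γ c) ∂μΓ = B.indicator (fun _ => (μΓ.real C : ℂ)) c := by
    intro c
    have hpt : ∀ ξ : Γ, (cosetProductMap Γ γ '' (C ×ˢ B)).indicator
        (fun _ => (1 : ℂ)) ((ξ : G) * γ c) =
        C.indicator (fun _ => B.indicator (fun _ => (1 : ℂ)) c) ξ := by
      intro ξ
      have hmem : (ξ : G) * γ c ∈ cosetProductMap Γ γ '' (C ×ˢ B) ↔ ξ ∈ C ∧ c ∈ B :=
        hγ.measurableEquiv.injective.mem_set_image (s := C ×ˢ B) (a := (ξ, c))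
      by_cases hξ : ξ ∈ C <;> by_cases hc : c ∈ B <;> simp [Set.indicator, hmem, hξ, hc]
    simp only [hpt]
    rw [integral_indicator hCm, setIntegral_const]
    by_cases hc : c ∈ B <;> simp [hc]
  simp only [hinner] at hformula
  rw [integral_indicator hm, integral_indicator hB, setIntegral_const, setIntegral_const] at hformula
  simp only [Complex.real_smul, mul_one] at hformula
  rw [mul_comm]
  exact_mod_cast hformula

theorem IsRightWeilMeasure.unique [T2Space G] [LocallyCompactSpace G]
    (hγ : IsCompactBorelSection Γ γ) (hΓ : IsClosed (Γ : Set G))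
    {μG : Measure G} [IsFiniteMeasureOnCompacts μG] {μΓ : Measure Γ} [μΓ.IsHaarMeasure]
    {ν ν' : Measure (RightCosets Γ)} (hν : IsRightWeilMeasure Γ μG μΓ γ ν)
    (hν' : IsRightWeilMeasure Γ μG μΓ γ ν') : ν = ν' := by
  have := RightCosets.t2Space hΓ
  have : LocallyCompactSpace Γ := hΓ.isClosedEmbedding_subtypeVal.locallyCompactSpace
  have := hν.regular
  have := hν'.regular
  obtain ⟨A⟩ : Nonempty (TopologicalSpace.PositiveCompacts Γ) := inferInstance
  have hA0 : μΓ.real A ≠ 0 :=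
    (ENNReal.toReal_pos (Measure.measure_pos_of_nonempty_interior μΓ A.interior_nonempty).ne'
      A.isCompact.measure_lt_top.ne).ne'
  let K : CompactExhaustion (RightCosets Γ) := default
  rw [Measure.ext_iff_of_iUnion_eq_univ K.iUnion_eq]
  refine fun n => Measure.ext fun B hB => ?_
  have hBn : MeasurableSet (B ∩ K n) := hB.inter (K.isCompact n).isClosed.measurableSet
  -- `measure_eq` compares only real values, where `⊤` becomes `0`; finiteness lifts the equality
  -- back to `ENNReal`.
  have hlt : ∀ (ρ : Measure (RightCosets Γ)) [IsFiniteMeasureOnCompacts ρ], ρ (B ∩ K n) ≠ ⊤ :=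
    fun ρ _ => ((measure_mono Set.inter_subset_right).trans_lt (K.isCompact n).measure_lt_top).ne
  have h := hν.measure_eq hγ A.isCompact A.isCompact.isClosed.measurableSet
    (K.isCompact n) hBn Set.inter_subset_right
  rw [hν'.measure_eq hγ A.isCompact A.isCompact.isClosed.measurableSet
    (K.isCompact n) hBn Set.inter_subset_right] at h
  rw [Measure.restrict_apply hB, Measure.restrict_apply hB]
  exact ((ENNReal.toReal_eq_toReal_iff' (hlt ν') (hlt ν)).1 (mul_left_cancel₀ hA0 h)).symm

end

/-- Composition with an isomorphism of measure spaces is a unitary map of `L²` spaces. -/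
theorem exists_linearIsometryEquiv_of_measurePreserving {X Y : Type*} [MeasurableSpace X]
    [MeasurableSpace Y] {μ : Measure X} {ν : Measure Y} (e : X ≃ᵐ Y)
    (he : MeasurePreserving e μ ν) :
    ∃ U : Lp ℂ 2 ν ≃ₗᵢ[ℂ] Lp ℂ 2 μ, ∀ f : Lp ℂ 2 ν, U f =ᵐ[μ] fun x => f (e x) := by
  refine ⟨LinearIsometryEquiv.ofSurjective (Lp.compMeasurePreservingₗᵢ ℂ e he) fun g => ?_,
    fun f => Lp.coeFn_compMeasurePreserving f he⟩
  refine ⟨Lp.compMeasurePreserving e.symm (he.symm e) g, Lp.ext ?_⟩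
  refine (Lp.coeFn_compMeasurePreserving _ he).trans ?_
  refine (he.quasiMeasurePreserving.ae_eq
    (Lp.coeFn_compMeasurePreserving g (he.symm e))).trans (Filter.Eventually.of_forall fun x => ?_)
  simp

theorem mainTheorem6 {G : Type*} [Group G] [TopologicalSpace G] [IsTopologicalGroup G]
    [T2Space G] [LocallyCompactSpace G] [SecondCountableTopology G]
    [MeasurableSpace G] [BorelSpace G]
    (Γ : Subgroup G) (hΓ : IsClosed (Γ : Set G))
    (μG : Measure G) [μG.IsHaarMeasure] (μΓ : Measure Γ) [μΓ.IsHaarMeasure]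
    (γ : RightCosets Γ → G) (hγ : IsCompactBorelSection Γ γ) :
    (∃! ν : Measure (RightCosets Γ), IsRightWeilMeasure Γ μG μΓ γ ν) ∧
    ∀ ν : Measure (RightCosets Γ), IsRightWeilMeasure Γ μG μΓ γ ν →
      IsMeasureSpaceIso (cosetProductMap Γ γ) (μΓ.prod ν) μG ∧
      ∃ U : Lp ℂ 2 μG ≃ₗᵢ[ℂ] Lp ℂ 2 (μΓ.prod ν),
        ∀ f : Lp ℂ 2 μG, U f =ᵐ[μΓ.prod ν] fun p => f (cosetProductMap Γ γ p) := by
  obtain ⟨ν₀, hreg, hmp⟩ := hγ.exists_measurePreserving hΓ μG μΓ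
  have hν₀ : IsRightWeilMeasure Γ μG μΓ γ ν₀ := .of_measurePreserving hγ hΓ hreg hmp
  refine ⟨⟨ν₀, hν₀, fun ν hν => hν.unique hγ hΓ hν₀⟩, fun ν hν => ?_⟩
  obtain rfl : ν = ν₀ := hν.unique hγ hΓ hν₀
  exact ⟨⟨hγ.measurableEquiv, fun _ => rfl, hmp⟩,
    exists_linearIsometryEquiv_of_measurePreserving hγ.measurableEquiv hmp⟩
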